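/- Setting. Let $(\mathbb{A},*)$ be a unital associative complex $*$-algebra with a Hausdorff topology making it a topological complex algebra with continuous involution, such that the unit group $\mathbb{A}^\times$ is open and inversion is continuous on it (a continuous inverse algebra; e.g. any $C^*$-algebra). Assume that $\mathbb{A}$ is a $P^*$-algebra: the real vector space $\mathrm{Herm}(\mathbb{A})=\{a\in\mathbb{A}: a^*=a\}$ carries a partial order making it an ordered real vector space, whose set $\Omega=\{x: x>0\}$ of positive elements contains $1$, consists of invertible elements, and satisfies $bab\in\Omega$ for all $a\in\Omega$ and all invertible $b\in\mathrm{Herm}(\mathbb{A})$, and $1+aba\in\Omega$ for all $a\in\mathrm{Herm}(\mathbb{A})$, $b\in\Omega$. Let $\mathcal{S}=\mathbb{A}\mathbb{P}^1$ be the projective line: the set of right submodules of $\mathbb{A}^2$ that are free of rank one and have a complement that is free of rank one. Write $a\top b$ (transversality) if $\mathbb{A}^2=a\oplus b$, and $[m]=m\mathbb{A}$. Let $N=[(1,i)]$, $S=[(1,-i)]$ be the poles. Writing elements of $\mathbb{A}^2$ as $(1,i)u+(1,-i)v$ with $u,v\in\mathbb{A}$, let $\tau$ be the map $z\mapsto z^{\perp}$,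 orthocomplement for the form $\beta((u,v),(u',v'))=u^*u'-v^*v'$, and let $\infty=(-1)_{N,S}$ be the antipode map induced by $(u,v)\mapsto(-u,v)$. Put $$\mathrm{U}=\{z\in\mathcal{S}:\tau(z)=z,\ z\top N,\ z\top S\},\qquad U^\tau_a=\{x\in\mathcal{S}:\tau(x)=x,\ x\top a\},$$ $$\mathcal{O}_{\mathrm U}=\{(a,b)\in\mathrm{U}^2: a\top\infty(b)\}\quad\text{(the space of complete observables)}.$$ For $p\in\mathrm{U}$ the cell $U^\tau_{\infty(p)}$ contains $p$. Its elements are the graphs of certain linear maps $p\to\infty(p)$, and addition and real multiples of these maps make it a real vector space $V_p=(U^\tau_{\infty(p)},p)$ with zero vector $p$. If $e_p$ is the element of $p$ whose component in $N$ is $\tfrac12(1,i)$, and $f_p=i\cdot(-1)_{N,S}\,e_p\in\infty(p)$, then $\mathrm{Herm}(\mathbb{A})\to U^\tau_{\infty(p)}$, $z\mapsto[e_p+f_pz]$ is a linear parametrization of $V_p$. The inverses of these maps, $p\in\mathrm{U}$, are the charts of $\mathrm{U}$, with values in $\mathrm{Herm}(\mathbb{A})$. A tangent vector of $\mathrm{U}$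 at $x$ is a family of vectors of $\mathrm{Herm}(\mathbb{A})$, one for each chart around $x$, which transform into each other by the real (Fréchet) derivatives of the changes of charts; $T_x\mathrm{U}$ is the real vector space of these, $T\mathrm{U}$ is the disjoint union of the $T_x\mathrm{U}$, and $\pi:T\mathrm{U}\to\mathrm{U}$ is the base projection. Fix a real number $\hbar\neq0$. By the Quantum Convention, a vector space $V$ and its tangent spaces $T_pV$ are identified by the usual identification multiplied by $\hbar$; let $Q_p:T_p\mathrm{U}=T_pV_p\to V_p=U^\tau_{\infty(p)}$ be the map so obtained. Theorem. For each $p\in\mathrm{U}$, one has $U^\tau_{\infty(p)}\subset\mathrm{U}$, and $Q_p:T_p\mathrm{U}\to U^\tau_{\infty(p)}$ is a bijection that sends $0$ to $p$ and is linear for the vector space structure of $V_p$. Moreover, with $v\in T_p\mathrm{U}$ identified with the point $Q_p(v)$ of $\mathrm{U}$, the map $$T\mathrm{U}\to\mathcal{O}_{\mathrm U},\qquad v\mapsto(\pi(v),v)=\bigl(\pi(v),Q_{\pi(v)}(v)\bigr)$$ is a bijection from the tangent bundle of $\mathrm{U}$ onto the space of complete observables. -/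

import Mathlib

namespace CompletedQM

noncomputable section

/-! ### `P^*`-algebras -/

/-- `Ω` is the set of positive elements `{x | 0 < x}` of a partial order that turns the real vector
space of Hermitian elements of `A` into an ordered Jordan algebra satisfying the `P^*`-axioms
(the order being recovered as `x ≤ y ↔ x = y ∨ y - x ∈ Ω`). -/
structure IsPStarCone {A : Type*} [Ring A] [StarRing A] [Algebra ℂ A] (Ω : Set A) : Prop where
  isSelfAdjoint : ∀ a ∈ Ω, IsSelfAdjoint a
  one_mem : (1 : A) ∈ Ω
  add_mem : ∀ a ∈ Ω, ∀ b ∈ Ω, a + b ∈ Ω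
  smul_mem : ∀ r : ℝ, 0 < r → ∀ a ∈ Ω, (r : ℂ) • a ∈ Ω
  neg_notMem : ∀ a ∈ Ω, -a ∉ Ω
  isUnit : ∀ a ∈ Ω, IsUnit a
  quad_mem : ∀ a ∈ Ω, ∀ b : A, IsSelfAdjoint b → IsUnit b → b * a * b ∈ Ω
  one_add_quad_mem : ∀ b ∈ Ω, ∀ a : A, IsSelfAdjoint a → 1 + a * b * a ∈ Ω

/-- A complex `*`-algebra is a `P^*`-algebra if its Hermitian part carries such an order. -/
def IsPStarAlgebra (A : Type*) [Ring A] [StarRing A] [Algebra ℂ A] : Prop :=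
  ∃ Ω : Set A, IsPStarCone Ω

/-! ### The projective line, the poles and the principal real form -/

section Algebraic

variable {A : Type*} [Ring A] [Algebra ℂ A]

/-- Right `A`-submodules of the right module `A²`. -/
abbrev RSub (A : Type*) [Ring A] := Submodule Aᵐᵒᵖ (A × A)

/-- `[m]`, the right submodule `{m a | a ∈ A}` generated by `m`. -/
abbrev pt (m : A × A) : RSub A := Submodule.span Aᵐᵒᵖ {m}

/-- The projective line `A P¹`: direct summands of `A²` which are free of rank one
and have a free complement of rank one. -/
def projLine (A : Type*) [Ring A] : Set (RSub A) :=
  {E | ∃ F : RSub A, IsCompl E F ∧ Nonempty (E ≃ₗ[Aᵐᵒᵖ] A) ∧ Nonempty (F ≃ₗ[Aᵐᵒᵖ] A)}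

/-- The generator `(1, i)` of the north pole. -/
def northVec (A : Type*) [Ring A] [Algebra ℂ A] : A × A := (1, algebraMap ℂ A Complex.I)

/-- The generator `(1, -i)` of the south pole. -/
def southVec (A : Type*) [Ring A] [Algebra ℂ A] : A × A := (1, -algebraMap ℂ A Complex.I)

/-- The north pole `N = [(1, i)]`. -/
def north (A : Type*) [Ring A] [Algebra ℂ A] : RSub A := pt (northVec A)

/-- The south pole `S = [(1, -i)]`. -/
def south (A : Type*) [Ring A] [Algebra ℂ A] : RSub A := pt (southVec A)

/-- The component `r` of `m = (1, i) r + (1, -i) s`. -/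
def nCoord : A × A →ₗ[Aᵐᵒᵖ] A where
  toFun m := (2⁻¹ : ℂ) • (m.1 - Complex.I • m.2)
  map_add' x y := by
    simp only [Prod.fst_add, Prod.snd_add, smul_add, smul_sub]; abel
  map_smul' a x := by
    simp [MulOpposite.smul_eq_mul_unop, sub_mul]

/-- The component `s` of `m = (1, i) r + (1, -i) s`. -/
def sCoord : A × A →ₗ[Aᵐᵒᵖ] A where
  toFun m := (2⁻¹ : ℂ) • (m.1 + Complex.I • m.2)
  map_add' x y := by
    simp only [Prod.fst_add, Prod.snd_add, smul_add]; abel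
  map_smul' a x := by
    simp [MulOpposite.smul_eq_mul_unop]

/-- `(r, s) ↦ (1, i) r + (1, -i) s`. -/
def poleComb : A × A →ₗ[Aᵐᵒᵖ] A × A where
  toFun r := (r.1 + r.2, Complex.I • (r.1 - r.2))
  map_add' x y := by
    ext
    · simp only [Prod.fst_add, Prod.snd_add]; abel
    · simp only [Prod.fst_add, Prod.snd_add, smul_sub, smul_add]; abel
  map_smul' a x := by
    ext <;> simp [MulOpposite.smul_eq_mul_unop, sub_mul]

theorem poleComb_eq (r s : A) :
    poleComb (r, s) = MulOpposite.op r • northVec A + MulOpposite.op s • southVec A := by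
  ext <;> simp [poleComb, northVec, southVec, Algebra.smul_def, sub_eq_add_neg, mul_add]

theorem poleComb_coord (m : A × A) : poleComb (nCoord m, sCoord m) = m := by
  have h2 : (2⁻¹ : ℂ) + 2⁻¹ = 1 := by norm_num
  have key : ∀ x : A, (2⁻¹ : ℂ) • x + (2⁻¹ : ℂ) • x = x := fun x => by
    rw [← add_smul, h2, one_smul]
  ext
  · change (2⁻¹ : ℂ) • (m.1 - Complex.I • m.2) + (2⁻¹ : ℂ) • (m.1 + Complex.I • m.2) = m.1
    rw [← smul_add, sub_add_add_cancel, smul_add, key]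
  · change Complex.I • ((2⁻¹ : ℂ) • (m.1 - Complex.I • m.2)
        - (2⁻¹ : ℂ) • (m.1 + Complex.I • m.2)) = m.2
    rw [← smul_sub, show m.1 - Complex.I • m.2 - (m.1 + Complex.I • m.2)
      = -(Complex.I • m.2 + Complex.I • m.2) by abel, smul_neg, smul_add, key, smul_neg, smul_smul,
      Complex.I_mul_I, neg_smul, one_smul, neg_neg]

theorem nCoord_poleComb (r s : A) : nCoord (poleComb (r, s)) = r := by
  change (2⁻¹ : ℂ) • (r + s - Complex.I • (Complex.I • (r - s))) = r
  rw [smul_smul, Complex.I_mul_I, neg_smul, one_smul,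
    show r + s - -(r - s) = r + r by abel, ← two_smul ℂ r, smul_smul]
  norm_num

theorem sCoord_poleComb (r s : A) : sCoord (poleComb (r, s)) = s := by
  change (2⁻¹ : ℂ) • (r + s + Complex.I • (Complex.I • (r - s))) = s
  rw [smul_smul, Complex.I_mul_I, neg_smul, one_smul,
    show r + s + -(r - s) = s + s by abel, ← two_smul ℂ s, smul_smul]
  norm_num

/-- The hyperbolic form `β(m, m') = u^* u' - v^* v'` on `A² = N ⊕ S ≅ A ⊕ A`, the poles being
identified with `A` by the generators `(1, i)` and `(1, -i)` (so that `O = [(1, 0)]` is the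
diagonal). -/
def form {A : Type*} [Ring A] [StarRing A] [Algebra ℂ A] (m m' : A × A) : A := star (nCoord m) * nCoord m' - star (sCoord m) * sCoord m'

/-- The principal involution `τ = τ^{NS}_O`: orthocomplement with respect to `form`. -/
def tau {A : Type*} [Ring A] [StarRing A] [Algebra ℂ A] (E : RSub A) : RSub A where
  carrier := {m | ∀ e ∈ E, form e m = 0}
  zero_mem' e _ := by simp [form]
  add_mem' {x y} hx hy e he := by
    have h1 := hx e he
    have h2 := hy e he
    simp only [form, map_add, mul_add] at h1 h2 ⊢
    rw [add_sub_add_comm, h1, h2, add_zero]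
  smul_mem' a x hx e he := by
    have h1 := hx e he
    simp only [form, map_smul, MulOpposite.smul_eq_mul_unop, ← mul_assoc, ← sub_mul] at h1 ⊢
    rw [h1, zero_mul]

/-- The dilation `λ_{N,S}`, with matrix `diag(λ, 1)` with respect to `A² = N ⊕ S`. -/
def dilation (c : ℂ) : A × A →ₗ[Aᵐᵒᵖ] A × A where
  toFun m := poleComb (c • nCoord m, sCoord m)
  map_add' x y := by
    rw [← map_add, map_add, map_add, smul_add, Prod.mk_add_mk]
  map_smul' a x := by
    rw [RingHom.id_apply, ← poleComb.map_smul, nCoord.map_smul, sCoord.map_smul, Prod.smul_mk, smul_comm c a]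

/-- The antipode map `∞ = (-1)_{N,S}`. -/
def antipode (E : RSub A) : RSub A := E.map (dilation (-1))

/-- The underlying set of the unitary torsor:
`U = {z ∈ A P¹ | τ(z) = z, z ⊤ N, z ⊤ S}`; transversality `⊤` is `IsCompl`. -/
def unitarySet (A : Type*) [Ring A] [StarRing A] [Algebra ℂ A] : Set (RSub A) :=
  {z | z ∈ projLine A ∧ tau z = z ∧ IsCompl z (north A) ∧ IsCompl z (south A)}

/-- The affine cell `U_a^τ = {x ∈ A P¹ | τ(x) = x, x ⊤ a}`. -/
def realCell {A : Type*} [Ring A] [StarRing A] [Algebra ℂ A] (a : RSub A) : Set (RSub A) :=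
  {x | x ∈ projLine A ∧ tau x = x ∧ IsCompl x a}

/-- The space of complete observables `O_U = {(a, b) ∈ U² | a ⊤ ∞(b)}`. -/
def completeObservables (A : Type*) [Ring A] [StarRing A] [Algebra ℂ A] : Set (RSub A × RSub A) :=
  {H | H.1 ∈ unitarySet A ∧ H.2 ∈ unitarySet A ∧ IsCompl H.1 (antipode H.2)}

/-! ### The vector space `V_p = (U^τ_{∞(p)}, p)`

A complement of `∞(p)` is the graph of a linear map `p → ∞(p)`. Addition and
real scalar multiplication in `V_p` are those of linear maps. -/

/-- The sum of `x` and `y` in `V_p`: the graph of the sum of the two linear maps. -/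
def cellAdd (p x y : RSub A) : RSub A where
  carrier := {m | ∃ e ∈ p, ∃ f ∈ antipode p, ∃ g ∈ antipode p,
    e + f ∈ x ∧ e + g ∈ y ∧ m = e + (f + g)}
  zero_mem' := ⟨0, zero_mem _, 0, zero_mem _, 0, zero_mem _, by simp, by simp, by simp⟩
  add_mem' := by
    rintro _ _ ⟨e, he, f, hf, g, hg, hx, hy, rfl⟩ ⟨e', he', f', hf', g', hg', hx', hy', rfl⟩
    refine ⟨e + e', add_mem he he', f + f', add_mem hf hf', g + g', add_mem hg hg', ?_, ?_, ?_⟩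
    · rw [add_add_add_comm]; exact add_mem hx hx'
    · rw [add_add_add_comm]; exact add_mem hy hy'
    · abel
  smul_mem' := by
    rintro a _ ⟨e, he, f, hf, g, hg, hx, hy, rfl⟩
    refine ⟨a • e, Submodule.smul_mem _ a he, a • f, Submodule.smul_mem _ a hf,
      a • g, Submodule.smul_mem _ a hg, ?_, ?_, ?_⟩
    · rw [← smul_add]; exact Submodule.smul_mem _ a hx
    · rw [← smul_add]; exact Submodule.smul_mem _ a hy
    · simp only [smul_add]

/-- The multiple `r x` in `V_p`: the graph of `r` times the linear map. -/
def cellSMul (p : RSub A) (r : ℝ) (x : RSub A) : RSub A where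
  carrier := {m | ∃ e ∈ p, ∃ f ∈ antipode p, e + f ∈ x ∧ m = e + (r : ℂ) • f}
  zero_mem' := ⟨0, zero_mem _, 0, zero_mem _, by simp, by simp⟩
  add_mem' := by
    rintro _ _ ⟨e, he, f, hf, hx, rfl⟩ ⟨e', he', f', hf', hx', rfl⟩
    refine ⟨e + e', add_mem he he', f + f', add_mem hf hf', ?_, ?_⟩
    · rw [add_add_add_comm]; exact add_mem hx hx'
    · rw [smul_add]; abel
  smul_mem' := by
    rintro a _ ⟨e, he, f, hf, hx, rfl⟩
    refine ⟨a • e, Submodule.smul_mem _ a he, a • f, Submodule.smul_mem _ a hf, ?_, ?_⟩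
    · rw [← smul_add]; exact Submodule.smul_mem _ a hx
    · rw [smul_add, smul_comm a (r : ℂ) f]

theorem nCoord_dilation (c : ℂ) (m : A × A) : nCoord (dilation c m) = c • nCoord m :=
  nCoord_poleComb _ _

theorem sCoord_dilation (c : ℂ) (m : A × A) : sCoord (dilation c m) = sCoord m :=
  sCoord_poleComb _ _

theorem ext_coord {m m' : A × A} (hn : nCoord m = nCoord m') (hs : sCoord m = sCoord m') :
    m = m' := by
  rw [← poleComb_coord m, hn, hs, poleComb_coord]

theorem mem_north_iff (m : A × A) : m ∈ north A ↔ sCoord m = 0 := by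
  constructor
  · intro h
    obtain ⟨a, rfl⟩ := Submodule.mem_span_singleton.1 h
    have := poleComb_eq a.unop (0 : A)
    rw [MulOpposite.op_zero, zero_smul, add_zero, MulOpposite.op_unop] at this
    rw [← this, sCoord_poleComb]
  · intro h
    rw [← poleComb_coord m, h, poleComb_eq, MulOpposite.op_zero, zero_smul, add_zero]
    exact Submodule.smul_mem _ _ (Submodule.mem_span_singleton_self _)

theorem mem_south_iff (m : A × A) : m ∈ south A ↔ nCoord m = 0 := by
  constructor
  · intro h
    obtain ⟨a, rfl⟩ := Submodule.mem_span_singleton.1 h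
    have := poleComb_eq (0 : A) a.unop
    rw [MulOpposite.op_zero, zero_smul, zero_add, MulOpposite.op_unop] at this
    rw [← this, nCoord_poleComb]
  · intro h
    rw [← poleComb_coord m, h, poleComb_eq, MulOpposite.op_zero, zero_smul, zero_add]
    exact Submodule.smul_mem _ _ (Submodule.mem_span_singleton_self _)

theorem two_cancel {M : Type*} [AddCommGroup M] [Module ℂ M] {x : M} (h : x + x = 0) : x = 0 := by
  rw [← two_smul ℂ x] at h
  exact (smul_eq_zero.1 h).resolve_left two_ne_zero

theorem isCompl_antipode_of_isCompl {p : RSub A} (hN : IsCompl p (north A))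
    (hS : IsCompl p (south A)) : IsCompl p (antipode p) := by
  constructor
  · rw [Submodule.disjoint_def]
    rintro m hm ⟨m', hm', rfl⟩
    have h1 : dilation (-1) m' + m' = 0 := by
      refine Submodule.disjoint_def.1 hS.disjoint _ (add_mem hm hm') ?_
      rw [mem_south_iff, map_add, nCoord_dilation, neg_one_smul, neg_add_cancel]
    have h2 : dilation (-1) m' - m' = 0 := by
      refine Submodule.disjoint_def.1 hN.disjoint _ (sub_mem hm hm') ?_
      rw [mem_north_iff, map_sub, sCoord_dilation, sub_self]
    have h3 : m' = dilation (-1) m' := (sub_eq_zero.1 h2).symm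
    refine two_cancel ?_
    nth_rewrite 2 [← h3]
    exact h1
  · rw [codisjoint_iff, eq_top_iff]
    intro x _
    obtain ⟨e, he, s, hs, hx⟩ : ∃ y ∈ p, ∃ z ∈ south A, y + z = x :=
      Submodule.mem_sup.1 (by rw [hS.sup_eq_top]; trivial)
    obtain ⟨e', he', n, hn, hx'⟩ : ∃ y ∈ p, ∃ z ∈ north A, y + z = x :=
      Submodule.mem_sup.1 (by rw [hN.sup_eq_top]; trivial)
    rw [mem_south_iff] at hs
    rw [mem_north_iff] at hn
    have h1 : nCoord x = nCoord e := by rw [← hx, map_add, hs, add_zero]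
    have h2 : sCoord x = sCoord e' := by rw [← hx', map_add, hn, add_zero]
    have key : x + x = (e + e') + dilation (-1) (e' - e) := by
      apply ext_coord
      · simp only [map_add, map_sub, nCoord_dilation, neg_one_smul, h1]; abel
      · simp only [map_add, map_sub, sCoord_dilation, h2]; abel
    have h4 : x + x ∈ p ⊔ antipode p := by
      rw [key]
      exact Submodule.add_mem_sup (add_mem he he')
        (Submodule.mem_map_of_mem (sub_mem he' he))
    have h5 : x = MulOpposite.op (algebraMap ℂ A 2⁻¹) • (x + x) := by
      have : (algebraMap ℂ A) 2⁻¹ + (algebraMap ℂ A) 2⁻¹ = 1 := by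
        rw [← map_add, ← map_one (algebraMap ℂ A)]; congr 1; norm_num
      rw [smul_add, ← add_smul, ← MulOpposite.op_add, this, MulOpposite.op_one, one_smul]
    rw [h5]
    exact Submodule.smul_mem _ _ h4

end Algebraic

section Charts

variable {A : Type*} [Ring A] [StarRing A] [Algebra ℂ A]

theorem isCompl_antipode {p : RSub A} (hp : p ∈ unitarySet A) : IsCompl p (antipode p) :=
  isCompl_antipode_of_isCompl hp.2.2.1 hp.2.2.2

/-- Each point `p` of `U` lies in its own cell `U^τ_{∞(p)}`. -/
theorem mem_realCell_self {p : RSub A} (hp : p ∈ unitarySet A) : p ∈ realCell (antipode p) :=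
  ⟨hp.1, hp.2.1, isCompl_antipode hp⟩

/-! ### The affine charts -/

/-- The basis of `p ∈ U` adapted to the poles: the element of `p` with component `(1, i) / 2` in `N`
(the projection of `(1, i) / 2` onto `p` along `S`); it is `(1, 0)` for `p = O = [(1, 0)]`. -/
def frameVec (p : unitarySet A) : A × A :=
  (2⁻¹ : ℂ) • Submodule.projection p.1 (south A) p.2.2.2.2 (northVec A)

/-- The corresponding basis of `∞(p)`; it is `(0, 1)` for `p = O`. -/
def coframeVec (p : unitarySet A) : A × A := Complex.I • dilation (-1) (frameVec p)

/-- The affine parametrization `Herm(A) → U^τ_{∞(p)}`, `z ↦ [e + f z]`, where `e` and `f` are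
the above bases of `p` and `∞(p)`; for `p = O` it is `z ↦ [(1, z)]`. -/
def param (p : unitarySet A) (z : selfAdjoint A) : RSub A :=
  pt (frameVec p + MulOpposite.op (z : A) • coframeVec p)

/-- The affine chart at `p`, inverse to `param p`; it is meaningful on `U^τ_{∞(p)}`. -/
def coord (p : unitarySet A) : RSub A → selfAdjoint A := Function.invFun (param p)

/-- The change of charts, from the chart at `p` to the chart at `q`; it is meaningful on the
coordinates in the chart at `p` of the points of `U^τ_{∞(p)} ∩ U^τ_{∞(q)}`. -/
def transition (p q : unitarySet A) : selfAdjoint A → selfAdjoint A := coord q ∘ param p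

/-- The charts at `x`: those charts whose domain contains `x`. -/
def ChartAt (x : unitarySet A) : Type _ := {p : unitarySet A // x.1 ∈ realCell (antipode p.1)}

/-- The chart centred at `x`. -/
def ChartAt.self (x : unitarySet A) : ChartAt x := ⟨x, mem_realCell_self x.2⟩

end Charts

/-! ### The tangent bundle -/

section Tangent

variable {A : Type*} [Ring A] [StarRing A] [Algebra ℂ A] [StarModule ℂ A] [TopologicalSpace A]

/-- The tangent space `T_x U`: a tangent vector is given by its components `v p ∈ Herm(A)` in all
affine charts `p` at `x`, subject to the transformation rule of tangent vectors under the (real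
Fréchet, in the sense of topological vector spaces) derivatives of the changes of charts. -/
def TangentSp (x : unitarySet A) : Submodule ℝ (ChartAt x → selfAdjoint A) where
  carrier := {v | ∀ p q : ChartAt x,
    v q = fderiv ℝ (transition p.1 q.1) (coord p.1 x.1) (v p)}
  zero_mem' p q := by simp
  add_mem' {v w} hv hw p q := by
    rw [Pi.add_apply, Pi.add_apply, map_add, ← hv p q, ← hw p q]
  smul_mem' r v hv p q := by
    rw [Pi.smul_apply, Pi.smul_apply, map_smul, ← hv p q]

/-- The tangent bundle `TU`; the base projection `π` is `Sigma.fst`. -/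
def TBundle (A : Type*) [Ring A] [StarRing A] [Algebra ℂ A] [StarModule ℂ A]
    [TopologicalSpace A] : Type _ :=
  Σ x : unitarySet A, TangentSp x

/-- The quantum identification of `T_x U = T_x V_x` with the vector space `V_x = (U^τ_{∞(x)}, x)`:
the usual identification of a vector space with its tangent spaces, multiplied by `ħ`
(in the linear chart at `x` of `V_x`, it sends a tangent vector with component `w` to `ħ w`). -/
def quantumIdent (hbar : ℝ) (x : unitarySet A) (v : TangentSp x) : RSub A :=
  param x (hbar • v.1 (ChartAt.self x))

end Tangent

end

end CompletedQM

namespace CompletedQM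

open Filter Topology Asymptotics NNReal ENNReal Set

/-! ### Differential calculus in topological vector spaces and algebras -/

section Calculus

variable {𝕜 : Type*} [NontriviallyNormedField 𝕜]

/-! In the coordinates `A² = N ⊕ S`, a point of `U` is the graph of left multiplication by a unique
unitary `g`: transversality to `S` makes it a graph, transversality to `N` makes `g` invertible, and
τ-invariance gives `g* g = 1`. The antipode replaces `g` by `-g`, and two graphs are transversal iff
the difference of their elements is invertible (`isCompl_graph_iff`). So the points `h` of `U` in
the cell at `g` are those with `h + g` invertible. This condition is symmetric in `g` and `h`, hence
the fibre of `O_U` over `p` is the cell of `∞(p)`, once that cell is known to lie in `U`.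

The parametrization at `g` is `z ↦ g c(z)`, where `c` is the Cayley transform (`param_eq_graph`).
The P*-axioms make `1 + z²`, hence `1 - iz`, invertible for every Hermitian `z`, so `c(z)` is always
defined and unitary. With surjectivity (`exists_param_eq`), the cell lies in `U` and is in bijection
with `Herm(A)`. As a linear map `p → ∞(p)`, the point with parameter `z` is multiplication by `-iz`,
so the parametrization is linear.

Changes of charts are differentiable by explicit difference formulas for `c` and its inverse. The
chain rule then gives a cocycle rule, so a tangent vector amounts to an arbitrary component in the
centred chart (`tangentSp_component_bijective`). Thus `Q_p` is a composite of three bijections: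
component, multiplication by ħ, parametrization. -/

theorem isLittleOTVS_mul_of_tendsto_zero {α R : Type*} [Ring R] [Algebra 𝕜 R] [TopologicalSpace R]
    [IsTopologicalRing R] [ContinuousSMul 𝕜 R] {l : Filter α} {ρ : α → R}
    (hρ : Tendsto ρ l (𝓝 0)) (g : α → R) : (fun y ↦ ρ y * g y) =o[𝕜; l] g := by
  refine ⟨fun U hU ↦ ?_⟩
  have hmul : Tendsto (fun p : R × R ↦ p.1 * p.2) (𝓝 0 ×ˢ 𝓝 0) (𝓝 0) := by
    rw [← nhds_prod_eq]
    exact continuous_mul.tendsto' _ _ (mul_zero 0)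
  obtain ⟨W, hW, V, hV, hWV⟩ := mem_prod_iff.1 (hmul hU)
  refine ⟨V, hV, fun ε hε ↦ ?_⟩
  -- Eventually `ρ y` lies in `t • W` with `‖t‖ < ε`. Writing `ρ y = t • w`, multiplication by `w`
  -- maps `V` into `U` and so does not increase gauges, while `t` contributes the factor `ε`.
  obtain ⟨t, ht0, htε⟩ := NormedField.exists_norm_lt 𝕜 (NNReal.coe_pos.2 (pos_iff_ne_zero.2 hε))
  have ht : t ≠ 0 := norm_pos_iff.1 ht0
  filter_upwards [hρ ((set_smul_mem_nhds_zero_iff ht).2 hW)] with y hy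
  obtain ⟨w, hw, hwy⟩ := hy
  have hmaps : MapsTo (LinearMap.mulLeft 𝕜 w) V U := fun v hv ↦ hWV (Set.mk_mem_prod hw hv)
  calc egauge 𝕜 U (ρ y * g y) = egauge 𝕜 U (t • (w * g y)) := by
        rw [← hwy]; simp only [smul_mul_assoc]
    _ = ‖t‖ₑ * egauge 𝕜 U (w * g y) := egauge_smul_right (fun h ↦ absurd h ht) _
    _ ≤ ε * egauge 𝕜 V (g y) := by
        refine mul_le_mul' ?_ (hmaps.egauge_le 𝕜 (LinearMap.mulLeft 𝕜 w) (g y))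
        rw [enorm_eq_nnnorm]
        exact_mod_cast htε.le

/-- The chain rule for maps between topological vector spaces. -/
theorem HasFDerivAt.comp_tvs {E F G : Type*}
    [AddCommGroup E] [Module 𝕜 E] [TopologicalSpace E] [ContinuousAdd E] [ContinuousSMul 𝕜 E]
    [AddCommGroup F] [Module 𝕜 F] [TopologicalSpace F] [ContinuousAdd F] [ContinuousSMul 𝕜 F]
    [AddCommGroup G] [Module 𝕜 G] [TopologicalSpace G] [ContinuousAdd G] [ContinuousSMul 𝕜 G]
    {f : E → F} {g : F → G} {f' : E →L[𝕜] F} {g' : F →L[𝕜] G} {x : E}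
    (hg : HasFDerivAt g g' (f x)) (hf : HasFDerivAt f f' x) :
    HasFDerivAt (g ∘ f) (g' ∘L f') x := by
  refine .of_isLittleOTVS ?_
  -- The remainder splits in two: that of `g` is `o(f y - f x)`, where `f y - f x = O(y - x)`, and
  -- that of `f` is carried over by the continuous map `g'`.
  have h1 : (fun y ↦ g (f y) - g (f x) - g' (f y - f x)) =o[𝕜; 𝓝 x] (fun y ↦ y - x) :=
    (hg.isLittleOTVS.comp_tendsto hf.continuousAt).trans_isBigOTVS hf.isBigOTVS_sub
  have h2 : (fun y ↦ g' (f y - f x - f' (y - x))) =o[𝕜; 𝓝 x] (fun y ↦ y - x) :=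
    g'.isBigOTVS_fun_comp.trans_isLittleOTVS hf.isLittleOTVS
  refine (h1.add h2).congr_left fun y ↦ ?_
  simp

/-- Carathéodory's criterion for differentiability, in a topological algebra. -/
theorem differentiableAt_of_sub_eq_mul {E F R : Type*}
    [AddCommGroup E] [Module 𝕜 E] [TopologicalSpace E]
    [AddCommGroup F] [Module 𝕜 F] [TopologicalSpace F]
    [Ring R] [Algebra 𝕜 R] [TopologicalSpace R] [IsTopologicalRing R] [ContinuousSMul 𝕜 R]
    {f : E → F} {x : E} {c : E → R} (T : E →L[𝕜] R) (S : R →L[𝕜] F) (hc : ContinuousAt c x)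
    (hf : ∀ᶠ y in 𝓝 x, f y - f x = S (c y * T (y - x))) : DifferentiableAt 𝕜 f x := by
  refine ⟨S ∘L (⟨LinearMap.mulLeft 𝕜 (c x), continuous_const_mul (c x)⟩ : R →L[𝕜] R) ∘L T,
    .of_isLittleOTVS ?_⟩
  have hρ : Tendsto (fun y ↦ c y - c x) (𝓝 x) (𝓝 0) := by
    simpa using hc.tendsto.sub (tendsto_const_nhds (x := c x))
  have h : (fun y ↦ S ((c y - c x) * T (y - x))) =o[𝕜; 𝓝 x] (fun y ↦ y - x) :=
    (S.isBigOTVS_fun_comp.trans_isLittleOTVS (isLittleOTVS_mul_of_tendsto_zero hρ _)).trans_isBigOTVS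
      T.isBigOTVS_fun_comp
  refine h.congr' ?_ .rfl
  filter_upwards [hf] with y hy
  change S ((c y - c x) * T (y - x)) = f y - f x - S (c x * T (y - x))
  rw [hy, sub_mul, map_sub]

end Calculus

end CompletedQM

namespace CompletedQM

/-! ### Graphs over the north pole and their transversality -/

section Graph

variable {A : Type*} [Ring A] [Algebra ℂ A]

theorem nCoord_smul (c : ℂ) (m : A × A) : nCoord (c • m) = c • nCoord m := by
  change (2⁻¹ : ℂ) • (c • m.1 - Complex.I • c • m.2) = c • (2⁻¹ : ℂ) • (m.1 - Complex.I • m.2)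
  rw [smul_comm Complex.I c, ← smul_sub, smul_comm]

theorem sCoord_smul (c : ℂ) (m : A × A) : sCoord (c • m) = c • sCoord m := by
  change (2⁻¹ : ℂ) • (c • m.1 + Complex.I • c • m.2) = c • (2⁻¹ : ℂ) • (m.1 + Complex.I • m.2)
  rw [smul_comm Complex.I c, ← smul_add, smul_comm]

/-- The graph of left multiplication by `g`, in the coordinates given by the poles. -/
def graph (g : A) : RSub A where
  carrier := {m | sCoord m = g * nCoord m}
  zero_mem' := by simp
  add_mem' {x y} hx hy := by
    simp only [Set.mem_ofPred_eq] at hx hy ⊢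
    rw [map_add, map_add, hx, hy, mul_add]
  smul_mem' a x hx := by
    simp only [Set.mem_ofPred_eq] at hx ⊢
    rw [map_smul, map_smul, hx, MulOpposite.smul_eq_mul_unop, MulOpposite.smul_eq_mul_unop,
      mul_assoc]

theorem mem_graph {g : A} {m : A × A} : m ∈ graph g ↔ sCoord m = g * nCoord m := Iff.rfl

theorem poleComb_mem_graph (g r : A) : poleComb (r, g * r) ∈ graph g := by
  rw [mem_graph, nCoord_poleComb, sCoord_poleComb]

theorem graph_injective : Function.Injective (graph : A → RSub A) := by
  intro g h hgh
  have := poleComb_mem_graph g 1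
  rw [hgh, mem_graph, nCoord_poleComb, sCoord_poleComb] at this
  simpa using this

theorem graph_zero : graph (0 : A) = north A := by
  ext m
  rw [mem_graph, mem_north_iff, zero_mul]

theorem antipode_graph (g : A) : antipode (graph g) = graph (-g) := by
  ext m
  constructor
  · rintro ⟨m', hm', rfl⟩
    rw [mem_graph, sCoord_dilation, nCoord_dilation, mem_graph.1 hm']
    simp
  · intro hm
    refine ⟨dilation (-1) m, ?_, ?_⟩
    · rw [SetLike.mem_coe, mem_graph, sCoord_dilation, nCoord_dilation, mem_graph.1 hm]
      simp
    · apply ext_coord <;> simp [nCoord_dilation, sCoord_dilation]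

/-- Decomposing the vector `(0, 1)` along the two graphs amounts to solving `(g - h) u = 1`.
Conversely, an inverse of `g - h` decomposes every vector. -/
theorem isCompl_graph_iff {g h : A} : IsCompl (graph g) (graph h) ↔ IsUnit (g - h) := by
  constructor
  · intro H
    obtain ⟨m, hm, m', hm', hmm⟩ : ∃ y ∈ graph g, ∃ z ∈ graph h, y + z = poleComb (0, 1) :=
      Submodule.mem_sup.1 (by rw [H.sup_eq_top]; trivial)
    have h1 : nCoord m' = -nCoord m := by
      rw [eq_neg_iff_add_eq_zero, add_comm, ← map_add, hmm, nCoord_poleComb]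
    have h2 : sCoord m + sCoord m' = 1 := by rw [← map_add, hmm, sCoord_poleComb]
    have hr : (g - h) * nCoord m = 1 := by
      rw [mem_graph.1 hm, mem_graph.1 hm', h1] at h2
      rw [sub_mul, ← h2, mul_neg, sub_eq_add_neg]
    set u := nCoord m
    -- A right inverse need not be two-sided. Here `g` and `h` agree on `u (g - h) - 1`, so the
    -- vector over it lies in both graphs and disjointness kills it.
    have ha : (g - h) * (u * (g - h) - 1) = 0 := by
      rw [mul_sub, ← mul_assoc, hr, one_mul, mul_one, sub_self]
    have h3 := poleComb_mem_graph g (u * (g - h) - 1)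
    have h4 := poleComb_mem_graph h (u * (g - h) - 1)
    rw [sub_mul, sub_eq_zero] at ha
    rw [← ha] at h4
    have h5 := congrArg nCoord (Submodule.disjoint_def.1 H.disjoint _ h3 h4)
    rw [nCoord_poleComb, map_zero, sub_eq_zero] at h5
    exact ⟨⟨g - h, u, hr, h5⟩, rfl⟩
  · rintro ⟨u, hu⟩
    constructor
    · rw [Submodule.disjoint_def]
      intro m hm hm'
      have h1 : (u : A) * nCoord m = 0 := by
        rw [hu, sub_mul, ← mem_graph.1 hm, ← mem_graph.1 hm', sub_self]
      have h2 : nCoord m = 0 := (Units.mul_right_eq_zero u).1 h1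
      apply ext_coord
      · rw [h2, map_zero]
      · rw [mem_graph.1 hm, h2, mul_zero, map_zero]
    · rw [codisjoint_iff, eq_top_iff]
      intro x _
      set a : A := ↑u⁻¹ * (sCoord x - h * nCoord x)
      have ha : g * a - h * a = sCoord x - h * nCoord x := by
        rw [← sub_mul, ← hu]; exact u.mul_inv_cancel_left _
      have : x = poleComb (a, g * a) + poleComb (nCoord x - a, h * (nCoord x - a)) := by
        apply ext_coord
        · rw [map_add, nCoord_poleComb, nCoord_poleComb]; abel
        · rw [map_add, sCoord_poleComb, sCoord_poleComb, mul_sub]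
          rw [sub_eq_iff_eq_add] at ha
          rw [ha]; abel
      rw [this]
      exact Submodule.add_mem_sup (poleComb_mem_graph _ _) (poleComb_mem_graph _ _)

theorem isCompl_graph_north {g : A} : IsCompl (graph g) (north A) ↔ IsUnit g := by
  rw [← graph_zero, isCompl_graph_iff, sub_zero]

theorem isCompl_graph_south (g : A) : IsCompl (graph g) (south A) := by
  constructor
  · rw [Submodule.disjoint_def]
    intro m hm hm'
    rw [mem_south_iff] at hm'
    apply ext_coord
    · rw [hm', map_zero]
    · rw [mem_graph.1 hm, hm', mul_zero, map_zero]
  · rw [codisjoint_iff, eq_top_iff]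
    intro x _
    have : x = poleComb (nCoord x, g * nCoord x) + poleComb (0, sCoord x - g * nCoord x) := by
      rw [← map_add, Prod.mk_add_mk, add_zero, add_sub_cancel, poleComb_coord]
    rw [this]
    refine Submodule.add_mem_sup (poleComb_mem_graph _ _) ?_
    rw [mem_south_iff, nCoord_poleComb]

/-- The projection `e` of `(1, i)` onto `p` along `S` has `N`-component 1. Any `m` in `p` equals `e`
times the `N`-component of `m`, since their difference lies in `p ∩ S`. -/
theorem exists_eq_graph_of_isCompl_south {p : RSub A} (hp : IsCompl p (south A)) :
    ∃ g, p = graph g := by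
  obtain ⟨e, he, s, hs, hes⟩ : ∃ y ∈ p, ∃ z ∈ south A, y + z = northVec A :=
    Submodule.mem_sup.1 (by rw [hp.sup_eq_top]; trivial)
  have hn : nCoord e = 1 := by
    have h1 : northVec A = poleComb (1, 0) := by
      rw [poleComb_eq]; simp
    have h2 := congrArg nCoord hes
    rwa [map_add, (mem_south_iff s).1 hs, add_zero, h1, nCoord_poleComb] at h2
  refine ⟨sCoord e, ?_⟩
  have hsub : ∀ a : A, nCoord (MulOpposite.op a • e) = a ∧
      sCoord (MulOpposite.op a • e) = sCoord e * a := fun a ↦ by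
    rw [map_smul, map_smul, hn]; simp
  ext m
  rw [mem_graph]
  constructor
  · intro hm
    have h1 : m - MulOpposite.op (nCoord m) • e = 0 := by
      refine Submodule.disjoint_def.1 hp.disjoint _ (sub_mem hm (Submodule.smul_mem _ _ he)) ?_
      rw [mem_south_iff, map_sub, (hsub _).1, sub_self]
    have h2 := congrArg sCoord (sub_eq_zero.1 h1)
    rwa [(hsub _).2] at h2
  · intro hm
    have : m = MulOpposite.op (nCoord m) • e := by
      apply ext_coord
      · rw [(hsub _).1]
      · rw [(hsub _).2, hm]
    rw [this]
    exact Submodule.smul_mem _ _ he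

/-- A graph is free of rank one. -/
noncomputable def graphEquiv (g : A) : graph g ≃ₗ[Aᵐᵒᵖ] A where
  toFun m := nCoord m.1
  map_add' x y := by simp
  map_smul' a x := by simp
  invFun a := ⟨poleComb (a, g * a), poleComb_mem_graph g a⟩
  left_inv m := by
    apply Subtype.ext
    change poleComb (nCoord m.1, g * nCoord m.1) = m.1
    rw [← mem_graph.1 m.2, poleComb_coord]
  right_inv a := nCoord_poleComb _ _

theorem isUnit_add_self {g : A} (hg : IsUnit g) : IsUnit (g + g) := by
  have : g + g = algebraMap ℂ A 2 * g := by rw [← Algebra.smul_def, two_smul]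
  rw [this]
  exact ((IsUnit.mk0 (2 : ℂ) two_ne_zero).map (algebraMap ℂ A)).mul hg

/-- The antipode `graph (-g)` is a free complement, because `g - (-g) = 2g` is invertible. -/
theorem graph_mem_projLine {g : A} (hg : IsUnit g) : graph g ∈ projLine A :=
  ⟨graph (-g), isCompl_graph_iff.2 (by rw [sub_neg_eq_add]; exact isUnit_add_self hg),
    ⟨graphEquiv g⟩, ⟨graphEquiv (-g)⟩⟩

theorem mem_pt_poleComb {r s : A} {m : A × A} :
    m ∈ pt (poleComb (r, s)) ↔ ∃ a, nCoord m = r * a ∧ sCoord m = s * a := by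
  rw [Submodule.mem_span_singleton]
  constructor
  · rintro ⟨a, rfl⟩
    refine ⟨a.unop, ?_, ?_⟩
    · rw [map_smul, nCoord_poleComb, MulOpposite.smul_eq_mul_unop]
    · rw [map_smul, sCoord_poleComb, MulOpposite.smul_eq_mul_unop]
  · rintro ⟨a, hn, hs⟩
    refine ⟨MulOpposite.op a, ?_⟩
    apply ext_coord
    · rw [map_smul, nCoord_poleComb, hn, MulOpposite.smul_eq_mul_unop, MulOpposite.unop_op]
    · rw [map_smul, sCoord_poleComb, hs, MulOpposite.smul_eq_mul_unop, MulOpposite.unop_op]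

end Graph

/-! ### Points of `U` as unitary elements -/

section Unitary

theorem isUnit_of_mem_unitary {A : Type*} [Ring A] [StarRing A] {g : A} (hg : g ∈ unitary A) : IsUnit g :=
  ⟨⟨g, star g, (Unitary.mem_iff.1 hg).2, (Unitary.mem_iff.1 hg).1⟩, rfl⟩

theorem mem_unitary_of_isUnit {A : Type*} [Ring A] [StarRing A] {g : A} (hg : IsUnit g) (h : star g * g = 1) : g ∈ unitary A := by
  obtain ⟨u, rfl⟩ := hg
  refine Unitary.mem_iff.2 ⟨h, ?_⟩
  rw [left_inv_eq_right_inv h u.mul_inv, u.mul_inv]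

variable {A : Type*} [Ring A] [StarRing A] [Algebra ℂ A]

/-- Orthogonality to the single vector `(1, g)` reads `n = g* s`, which is `s = g n` because `g g* =
1`. The reverse inclusion uses `g* g = 1`. -/
theorem tau_graph {g : A} (hg : g ∈ unitary A) : tau (graph g) = graph g := by
  obtain ⟨h1, h2⟩ := Unitary.mem_iff.1 hg
  ext m
  constructor
  · intro hm
    have h := hm _ (poleComb_mem_graph g 1)
    rw [form, nCoord_poleComb, sCoord_poleComb, star_one, one_mul, mul_one, sub_eq_zero] at h
    rw [mem_graph, h, ← mul_assoc, h2, one_mul]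
  · intro hm e he
    rw [form, mem_graph.1 hm, mem_graph.1 he, star_mul, mul_assoc, ← mul_assoc (star g), h1,
      one_mul, sub_self]

theorem graph_mem_unitarySet {g : A} (hg : g ∈ unitary A) : graph g ∈ unitarySet A :=
  ⟨graph_mem_projLine (isUnit_of_mem_unitary hg), tau_graph hg,
    isCompl_graph_north.2 (isUnit_of_mem_unitary hg), isCompl_graph_south g⟩

theorem form_eq_zero_of_tau_eq {p : RSub A} (hp : tau p = p) {m : A × A} (hm : m ∈ p) :
    form m m = 0 := by
  have h : m ∈ tau p := hp.symm ▸ hm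
  exact h m hm

/-- Isotropy of `(1, g)` gives `g* g = 1`; transversality to `N` makes `g` invertible, which turns
`g*` into a two-sided inverse. -/
theorem exists_eq_graph {p : RSub A} (hp : p ∈ unitarySet A) : ∃ g ∈ unitary A, p = graph g := by
  obtain ⟨-, htau, hN, hS⟩ := hp
  obtain ⟨g, rfl⟩ := exists_eq_graph_of_isCompl_south hS
  refine ⟨g, mem_unitary_of_isUnit (isCompl_graph_north.1 hN) ?_, rfl⟩
  have h := form_eq_zero_of_tau_eq htau (poleComb_mem_graph g 1)
  rw [form, nCoord_poleComb, sCoord_poleComb, star_one, mul_one, mul_one, sub_eq_zero] at h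
  exact h.symm

theorem graph_mem_realCell_iff {g h : A} (hh : h ∈ unitary A) :
    graph h ∈ realCell (antipode (graph g)) ↔ IsUnit (h + g) := by
  rw [antipode_graph, ← sub_neg_eq_add, ← isCompl_graph_iff]
  exact ⟨fun H ↦ H.2.2, fun H ↦ ⟨graph_mem_projLine (isUnit_of_mem_unitary hh), tau_graph hh, H⟩⟩

end Unitary

/-! ### The affine parametrizations in pole coordinates -/

section Param

variable {A : Type*} [Ring A] [StarRing A] [Algebra ℂ A]

theorem frameVec_eq {p : unitarySet A} {g : A} (hp : p.1 = graph g) :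
    frameVec p = (2⁻¹ : ℂ) • poleComb (1, g) := by
  have h1 : northVec A = poleComb (1, g) + poleComb (0, -g) := by
    rw [← map_add, Prod.mk_add_mk, poleComb_eq]; simp
  have h2 : poleComb (1, g) ∈ p.1 := by
    simpa [hp] using poleComb_mem_graph g 1
  have h3 : poleComb (0, -g) ∈ south A := by rw [mem_south_iff, nCoord_poleComb]
  rw [frameVec, h1, map_add, Submodule.projection_apply_of_mem_left _ h2,
    (Submodule.projection_apply_eq_zero_iff _).2 h3, add_zero]

theorem nCoord_frame {p : unitarySet A} {g : A} (hp : p.1 = graph g) (z : A) :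
    nCoord (frameVec p + MulOpposite.op z • coframeVec p) =
      (1 - Complex.I • z) * algebraMap ℂ A 2⁻¹ := by
  rw [map_add, map_smul, coframeVec, nCoord_smul, nCoord_dilation, frameVec_eq hp, nCoord_smul,
    nCoord_poleComb, ← Algebra.commutes, ← Algebra.smul_def]
  rw [smul_sub, MulOpposite.smul_eq_mul_unop, MulOpposite.unop_op, smul_mul_assoc, smul_mul_assoc,
    smul_mul_assoc, one_mul, neg_one_smul, smul_neg, ← sub_eq_add_neg, smul_comm]

theorem sCoord_frame {p : unitarySet A} {g : A} (hp : p.1 = graph g) (z : A) :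
    sCoord (frameVec p + MulOpposite.op z • coframeVec p) =
      g * (1 + Complex.I • z) * algebraMap ℂ A 2⁻¹ := by
  rw [map_add, map_smul, coframeVec, sCoord_smul, sCoord_dilation, frameVec_eq hp, sCoord_smul,
    sCoord_poleComb, ← Algebra.commutes, ← Algebra.smul_def]
  rw [mul_add, mul_one, mul_smul_comm, smul_add, MulOpposite.smul_eq_mul_unop, MulOpposite.unop_op,
    smul_mul_assoc, smul_mul_assoc, smul_comm]

/-- The generator has pole coordinates `(1 - iz, g (1 + iz))` up to the invertible factor `1/2`,
which is absorbed into `a`. -/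
theorem mem_param {p : unitarySet A} {g : A} (hp : p.1 = graph g) (z : selfAdjoint A)
    {m : A × A} : m ∈ param p z ↔ ∃ a, nCoord m = (1 - Complex.I • (z : A)) * a ∧
      sCoord m = g * (1 + Complex.I • (z : A)) * a := by
  have hm : frameVec p + MulOpposite.op (z : A) • coframeVec p =
      poleComb ((1 - Complex.I • (z : A)) * algebraMap ℂ A 2⁻¹,
        g * (1 + Complex.I • (z : A)) * algebraMap ℂ A 2⁻¹) := by
    rw [← nCoord_frame hp, ← sCoord_frame hp, poleComb_coord]
  have h2 : algebraMap ℂ A 2⁻¹ * algebraMap ℂ A 2 = 1 := by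
    rw [← map_mul, inv_mul_cancel₀ two_ne_zero, map_one]
  rw [param, hm, mem_pt_poleComb]
  constructor
  · rintro ⟨a, h⟩
    exact ⟨algebraMap ℂ A 2⁻¹ * a, by simpa only [mul_assoc] using h⟩
  · rintro ⟨a, hn, hs⟩
    refine ⟨algebraMap ℂ A 2 * a, ?_, ?_⟩
    · rw [hn, mul_assoc, ← mul_assoc _ _ a, h2, one_mul]
    · rw [hs, mul_assoc _ (algebraMap ℂ A 2⁻¹), ← mul_assoc _ _ a, h2, one_mul]

end Param
end CompletedQM

namespace CompletedQM

/-! ### The Cayley transform and its difference formulas -/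

section Cayley

theorem inverse_sub_inverse {A : Type*} [Ring A] {x y : A} (hx : IsUnit x) (hy : IsUnit y) :
    Ring.inverse x - Ring.inverse y = Ring.inverse x * (y - x) * Ring.inverse y := by
  rw [mul_sub, sub_mul, Ring.inverse_mul_cancel _ hx, one_mul, Ring.mul_inverse_cancel_right _ _ hy]

variable {A : Type*} [Ring A] [Algebra ℂ A]

/-- The Cayley transform `(1 + i z) (1 - i z)⁻¹`. -/
noncomputable def cayley (z : A) : A := (1 + Complex.I • z) * Ring.inverse (1 - Complex.I • z)

/-- The inverse Cayley transform `-i (k - 1) (k + 1)⁻¹`. -/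
noncomputable def invCayley (k : A) : A := -Complex.I • (1 - (2 : ℂ) • Ring.inverse (k + 1))

theorem cayley_mul {z : A} (hz : IsUnit (1 - Complex.I • z)) :
    cayley z * (1 - Complex.I • z) = 1 + Complex.I • z :=
  Ring.inverse_mul_cancel_right _ _ hz

/-- Adding 1 turns the Cayley transform into a multiple of a single inverse. Its inversion and its
difference formula are read off from this. -/
theorem cayley_add_one {z : A} (hz : IsUnit (1 - Complex.I • z)) :
    cayley z + 1 = (2 : ℂ) • Ring.inverse (1 - Complex.I • z) := by
  nth_rewrite 1 [← Ring.mul_inverse_cancel _ hz, cayley]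
  rw [← add_mul, add_add_sub_cancel, add_mul, one_mul, two_smul]

theorem isUnit_cayley_add_one {z : A} (hz : IsUnit (1 - Complex.I • z)) :
    IsUnit (cayley z + 1) := by
  rw [cayley_add_one hz, Algebra.smul_def]
  exact ((IsUnit.mk0 (2 : ℂ) two_ne_zero).map (algebraMap ℂ A)).mul hz.ringInverse

theorem inverse_cayley_add_one {z : A} (hz : IsUnit (1 - Complex.I • z)) :
    (2 : ℂ) • Ring.inverse (cayley z + 1) = 1 - Complex.I • z := by
  have h1 : (1 - Complex.I • z) * (cayley z + 1) = (2 : ℂ) • 1 := by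
    rw [cayley_add_one hz, mul_smul_comm, Ring.mul_inverse_cancel _ hz]
  rw [← one_mul (Ring.inverse _), ← smul_mul_assoc, ← h1]
  exact Ring.mul_inverse_cancel_right _ _ (isUnit_cayley_add_one hz)

theorem invCayley_cayley {z : A} (hz : IsUnit (1 - Complex.I • z)) : invCayley (cayley z) = z := by
  rw [invCayley, inverse_cayley_add_one hz, sub_sub_cancel, smul_smul]
  simp

/-- A resolvent identity. Together with `invCayley_sub_invCayley`, it exhibits increments as
products containing `z - w`, as Carathéodory's criterion requires. -/
theorem cayley_sub_cayley {z w : A} (hz : IsUnit (1 - Complex.I • z))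
    (hw : IsUnit (1 - Complex.I • w)) : cayley z - cayley w = (2 * Complex.I) •
      (Ring.inverse (1 - Complex.I • z) * (z - w) * Ring.inverse (1 - Complex.I • w)) := by
  rw [← add_sub_add_right_eq_sub _ _ 1, cayley_add_one hz, cayley_add_one hw, ← smul_sub,
    inverse_sub_inverse hz hw, sub_sub_sub_cancel_left, ← smul_sub, mul_smul_comm, smul_mul_assoc,
    smul_smul]

theorem invCayley_sub_invCayley {k l : A} (hk : IsUnit (k + 1)) (hl : IsUnit (l + 1)) :
    invCayley k - invCayley l = (-2 * Complex.I) •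
      (Ring.inverse (k + 1) * (k - l) * Ring.inverse (l + 1)) := by
  rw [invCayley, invCayley, ← smul_sub, sub_sub_sub_cancel_left, ← smul_sub,
    ← neg_sub (Ring.inverse (k + 1)), inverse_sub_inverse hk hl, add_sub_add_right_eq_sub,
    ← neg_sub k l, mul_neg, neg_mul, neg_neg, smul_smul, neg_mul, neg_mul, mul_comm]

end Cayley

/-! ### Consequences of the P*-axioms: charts and their changes -/

section PStar

variable {A : Type*} [Ring A] [StarRing A] [Algebra ℂ A]

/-- The element `1 + z 1 z` is positive, hence invertible, and it is the product of the commuting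
factors `1 - iz` and `1 + iz`. The order axioms enter the proof only here. -/
theorem isUnit_one_sub_I_smul (hpos : IsPStarAlgebra A) {z : A} (hz : IsSelfAdjoint z) :
    IsUnit (1 - Complex.I • z) := by
  obtain ⟨Ω, hΩ⟩ := hpos
  have h1 := hΩ.isUnit _ (hΩ.one_add_quad_mem 1 hΩ.one_mem z hz)
  have hI : (Complex.I • z) * (Complex.I • z) = -(z * z) := by
    rw [smul_mul_smul_comm, Complex.I_mul_I, neg_one_smul]
  have h2 : (1 - Complex.I • z) * (1 + Complex.I • z) = 1 + z * 1 * z := by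
    rw [mul_one, sub_mul, mul_add, mul_add, hI, one_mul, one_mul, mul_one]; abel
  have hc : Commute (1 - Complex.I • z) (1 + Complex.I • z) :=
    (Commute.one_left _).sub_left ((Commute.one_right _).add_right (Commute.refl _))
  rw [← h2, hc.isUnit_mul_iff] at h1
  exact h1.1

/-- The involution exchanges the commuting elements `1 - iz` and `1 + iz`. So `(1 + iz) c* c = (1 -
iz) c = 1 + iz`, and `1 + iz` cancels. -/
theorem cayley_mem_unitary [StarModule ℂ A] (hpos : IsPStarAlgebra A) {z : A}
    (hz : IsSelfAdjoint z) : cayley z ∈ unitary A := by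
  have hr := isUnit_one_sub_I_smul hpos hz
  have hs : IsUnit (1 + Complex.I • z) := by
    have := isUnit_one_sub_I_smul hpos hz.neg
    rwa [smul_neg, sub_neg_eq_add] at this
  have hstar : star (1 - Complex.I • z) = 1 + Complex.I • z := by
    rw [star_sub, star_one, star_smul, hz.star_eq]
    simp
  have h1 := cayley_mul hr
  have h2 : (1 + Complex.I • z) * star (cayley z) = 1 - Complex.I • z := by
    have := congrArg star h1
    rwa [star_mul, hstar, ← hstar, star_star, hstar] at this
  have hc : Commute (1 - Complex.I • z) (1 + Complex.I • z) := by
    refine (Commute.one_left _).sub_left ?_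
    exact (Commute.one_right _).add_right (Commute.refl _)
  have h3 : (1 - Complex.I • z) * cayley z = 1 + Complex.I • z := by
    rw [cayley, ← mul_assoc, hc.eq, Ring.mul_inverse_cancel_right _ _ hr]
  refine mem_unitary_of_isUnit (hs.mul hr.ringInverse) (hs.mul_left_cancel ?_)
  rw [← mul_assoc, h2, h3, mul_one]

/-- Since `1 - iz` is invertible, the generator `(1 - iz, g (1 + iz))` can be normalized to have
first coordinate 1. -/
theorem param_eq_graph (hpos : IsPStarAlgebra A) {p : unitarySet A} {g : A}
    (hp : p.1 = graph g) (z : selfAdjoint A) : param p z = graph (g * cayley (z : A)) := by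
  have hr := isUnit_one_sub_I_smul hpos z.2
  ext m
  rw [mem_param hp, mem_graph]
  constructor
  · rintro ⟨a, hn, hs⟩
    rw [hn, hs, ← cayley_mul hr]
    simp only [mul_assoc]
  · intro hm
    refine ⟨Ring.inverse (1 - Complex.I • (z : A)) * nCoord m, ?_, ?_⟩
    · rw [Ring.mul_inverse_cancel_left _ _ hr]
    · rw [hm, cayley]; simp only [mul_assoc]

theorem param_injective (hpos : IsPStarAlgebra A) (p : unitarySet A) :
    Function.Injective (param p) := by
  obtain ⟨g, hg, hp⟩ := exists_eq_graph p.2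
  intro z w hzw
  rw [param_eq_graph hpos hp, param_eq_graph hpos hp] at hzw
  have h := (isUnit_of_mem_unitary hg).mul_left_cancel (graph_injective hzw)
  apply Subtype.ext
  rw [← invCayley_cayley (isUnit_one_sub_I_smul hpos z.2), h,
    invCayley_cayley (isUnit_one_sub_I_smul hpos w.2)]

theorem coord_param (hpos : IsPStarAlgebra A) (p : unitarySet A) (z : selfAdjoint A) :
    coord p (param p z) = z :=
  Function.leftInverse_invFun (param_injective hpos p) z

theorem param_mem_unitarySet [StarModule ℂ A] (hpos : IsPStarAlgebra A) (p : unitarySet A)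
    (z : selfAdjoint A) : param p z ∈ unitarySet A := by
  obtain ⟨g, hg, hp⟩ := exists_eq_graph p.2
  rw [param_eq_graph hpos hp]
  exact graph_mem_unitarySet (mul_mem hg (cayley_mem_unitary hpos z.2))

theorem param_mem_realCell [StarModule ℂ A] (hpos : IsPStarAlgebra A) (p : unitarySet A)
    (z : selfAdjoint A) : param p z ∈ realCell (antipode p.1) := by
  obtain ⟨g, hg, hp⟩ := exists_eq_graph p.2
  rw [param_eq_graph hpos hp, hp,
    graph_mem_realCell_iff (mul_mem hg (cayley_mem_unitary hpos z.2))]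
  have h : g * cayley (z : A) + g = g * (cayley (z : A) + 1) := by rw [mul_add, mul_one]
  rw [h]
  exact (isUnit_of_mem_unitary hg).mul (isUnit_cayley_add_one (isUnit_one_sub_I_smul hpos z.2))

/-- Splitting `(1, g) = m + f` along `x ⊕ ∞(p)` gives `m = (1 - b, g (1 + b))`. Isotropy of `m`
forces `b* = -b`, so `z = -ib` is Hermitian, and `m` generates `x`. -/
theorem exists_param_eq [StarModule ℂ A] {p : unitarySet A} {x : RSub A}
    (hx : x ∈ realCell (antipode p.1)) : ∃ z, param p z = x := by
  obtain ⟨g, hg, hp⟩ := exists_eq_graph p.2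
  obtain ⟨hg1, hg2⟩ := Unitary.mem_iff.1 hg
  obtain ⟨-, htau, hcompl⟩ := hx
  rw [hp, antipode_graph] at hcompl
  obtain ⟨m, hm, f, hf, hmf⟩ : ∃ y ∈ x, ∃ z ∈ graph (-g), y + z = poleComb (1, g) :=
    Submodule.mem_sup.1 (by rw [hcompl.sup_eq_top]; trivial)
  set b := nCoord f with hb
  have hn : nCoord m = 1 - b := by
    rw [eq_sub_iff_add_eq, hb, ← map_add, hmf, nCoord_poleComb]
  have hs : sCoord m = g * (1 + b) := by
    have h1 := congrArg sCoord hmf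
    rw [map_add, sCoord_poleComb, mem_graph.1 hf, neg_mul, ← sub_eq_add_neg,
      sub_eq_iff_eq_add] at h1
    rw [h1, mul_add, mul_one]
  have hbstar : star b = -b := by
    have h1 := form_eq_zero_of_tau_eq htau hm
    rw [form, hn, hs, star_mul, mul_assoc, ← mul_assoc (star g), hg1, one_mul, star_sub, star_add,
      star_one] at h1
    have h2 : (star b + b) + (star b + b) = 0 := by
      rw [← neg_eq_zero, ← h1]
      noncomm_ring
    exact eq_neg_of_add_eq_zero_left (two_cancel h2)
  have hw : IsSelfAdjoint (-Complex.I • b) := by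
    rw [IsSelfAdjoint, star_smul, hbstar]
    simp
  have hIw : Complex.I • (-Complex.I • b) = b := by
    rw [smul_smul]; simp
  refine ⟨⟨-Complex.I • b, hw⟩, ?_⟩
  ext m'
  rw [mem_param hp]
  simp only [hIw]
  rw [← hn, ← hs]
  constructor
  · rintro ⟨a, h1, h2⟩
    have : m' = MulOpposite.op a • m := by
      apply ext_coord
      · rw [h1, map_smul, MulOpposite.smul_eq_mul_unop, MulOpposite.unop_op]
      · rw [h2, map_smul, MulOpposite.smul_eq_mul_unop, MulOpposite.unop_op]
    rw [this]
    exact Submodule.smul_mem _ _ hm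
  · intro hm'
    -- This is the `p`-coordinate of `m'` in `p ⊕ ∞(p)`. That of `m` is 1, so `m' - m a` lies in
    -- `∞(p)` as well as in `x`, and therefore vanishes.
    set a : A := (2⁻¹ : ℂ) • (nCoord m' + star g * sCoord m') with ha
    have ha2 : a + a = nCoord m' + star g * sCoord m' := by
      rw [← two_smul ℂ a, ha, smul_smul, mul_inv_cancel₀ two_ne_zero, one_smul]
    have hna : nCoord (m' - MulOpposite.op a • m) = nCoord m' - (1 - b) * a := by
      rw [map_sub, map_smul, MulOpposite.smul_eq_mul_unop, MulOpposite.unop_op, hn]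
    have hsa : sCoord (m' - MulOpposite.op a • m) = sCoord m' - g * (1 + b) * a := by
      rw [map_sub, map_smul, MulOpposite.smul_eq_mul_unop, MulOpposite.unop_op, hs]
    have h1 : m' - MulOpposite.op a • m ∈ graph (-g) := by
      rw [mem_graph, hna, hsa]
      have h2 : sCoord m' = g * (a + a) - g * nCoord m' := by
        rw [ha2, mul_add, ← mul_assoc, hg2, one_mul, add_sub_cancel_left]
      rw [h2]
      noncomm_ring
    have h2 := sub_eq_zero.1 (Submodule.disjoint_def.1 hcompl.disjoint _
      (sub_mem hm' (Submodule.smul_mem _ _ hm)) h1)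
    refine ⟨a, ?_, ?_⟩
    · nth_rewrite 1 [h2]
      rw [map_smul, MulOpposite.smul_eq_mul_unop, MulOpposite.unop_op]
    · nth_rewrite 1 [h2]
      rw [map_smul, MulOpposite.smul_eq_mul_unop, MulOpposite.unop_op]

theorem param_bijOn [StarModule ℂ A] (hpos : IsPStarAlgebra A) (p : unitarySet A) :
    Set.BijOn (param p) Set.univ (realCell (antipode p.1)) :=
  ⟨fun z _ ↦ param_mem_realCell hpos p z, (param_injective hpos p).injOn,
    fun _ hx ↦ (exists_param_eq hx).imp fun _ h ↦ ⟨trivial, h⟩⟩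

theorem param_zero (hpos : IsPStarAlgebra A) (p : unitarySet A) : param p 0 = p.1 := by
  obtain ⟨g, hg, hp⟩ := exists_eq_graph p.2
  rw [param_eq_graph hpos hp, hp]
  simp [cayley]

theorem param_coord [StarModule ℂ A] (hpos : IsPStarAlgebra A) {p : unitarySet A} {x : RSub A}
    (hx : x ∈ realCell (antipode p.1)) : param p (coord p x) = x := by
  obtain ⟨z, rfl⟩ := exists_param_eq hx
  rw [coord_param hpos]

/-- Parameters `z` at `g` and `w` at `h` give the same point iff `g c(z) = h c(w)`. The assumption
on `z` says that its point lies in the cell at `h`, so that such a `w` exists. -/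
theorem transition_eq [StarModule ℂ A] (hpos : IsPStarAlgebra A) {p q : unitarySet A} {g h : A}
    (hg : g ∈ unitary A) (hh : h ∈ unitary A) (hp : p.1 = graph g) (hq : q.1 = graph h)
    {z : selfAdjoint A} (hz : IsUnit (g * cayley (z : A) + h)) :
    (transition p q z : A) = invCayley (star h * g * cayley (z : A)) := by
  have h1 : param p z ∈ realCell (antipode q.1) := by
    rwa [param_eq_graph hpos hp, hq,
      graph_mem_realCell_iff (mul_mem hg (cayley_mem_unitary hpos z.2))]
  obtain ⟨w, hw⟩ := exists_param_eq h1
  have h2 : transition p q z = w := by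
    rw [transition, Function.comp_apply, ← hw, coord_param hpos]
  rw [param_eq_graph hpos hp, param_eq_graph hpos hq] at hw
  rw [h2, mul_assoc, ← graph_injective hw, ← mul_assoc, (Unitary.mem_iff.1 hh).1, one_mul,
    invCayley_cayley (isUnit_one_sub_I_smul hpos w.2)]

end PStar

/-! ### Linearity of the parametrizations -/

section VectorSpace

variable {A : Type*} [Ring A] [StarRing A] [Algebra ℂ A]

/-- With `N`-components as coordinates on both `p` and `∞(p)`, the parameter `z` becomes the linear
map "multiply by `-iz`", which is additive and real homogeneous in `z`. -/
theorem add_mem_param_iff {p : unitarySet A} {g : A} (hg : g ∈ unitary A) (hp : p.1 = graph g)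
    {z : selfAdjoint A} {e f : A × A} (he : e ∈ p.1) (hf : f ∈ antipode p.1) :
    e + f ∈ param p z ↔ nCoord f = -(Complex.I • (z : A)) * nCoord e := by
  rw [hp, antipode_graph] at hf
  rw [hp] at he
  rw [mem_param hp, map_add, map_add, mem_graph.1 he, mem_graph.1 hf]
  constructor
  · rintro ⟨a, hn, hs⟩
    rw [neg_mul, ← mul_neg, ← mul_add, mul_assoc] at hs
    replace hs := (isUnit_of_mem_unitary hg).mul_left_cancel hs
    have h1 : nCoord e = a := by
      -- Adding the two coordinate equations cancels `f` and `z`, leaving twice the `N`-component of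
      -- `e` equal to `2a`.
      have h2 : (nCoord e - a) + (nCoord e - a) = 0 := by
        have h3 := congrArg₂ (· + ·) hn hs
        simp only [sub_mul, add_mul, one_mul] at h3
        rw [← sub_eq_zero] at h3
        rw [← h3]
        abel
      exact sub_eq_zero.1 (two_cancel h2)
    rw [h1, sub_mul, one_mul, sub_eq_add_neg] at hn
    rw [h1, add_left_cancel hn, neg_mul]
  · intro h
    refine ⟨nCoord e, ?_, ?_⟩
    · rw [h, sub_mul, one_mul, neg_mul, sub_eq_add_neg]
    · rw [h]
      generalize Complex.I • (z : A) = b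
      noncomm_ring

theorem mem_param_iff_exists_add {p : unitarySet A} {g : A} (hg : g ∈ unitary A)
    (hp : p.1 = graph g) {z : selfAdjoint A} {m : A × A} :
    m ∈ param p z ↔ ∃ e ∈ p.1, ∃ f ∈ antipode p.1,
      nCoord f = -(Complex.I • (z : A)) * nCoord e ∧ m = e + f := by
  constructor
  · intro hm
    obtain ⟨e, he, f, hf, rfl⟩ : ∃ y ∈ p.1, ∃ w ∈ antipode p.1, y + w = m :=
      Submodule.mem_sup.1 (by rw [(isCompl_antipode p.2).sup_eq_top]; trivial)
    exact ⟨e, he, f, hf, (add_mem_param_iff hg hp he hf).1 hm, rfl⟩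
  · rintro ⟨e, he, f, hf, h, rfl⟩
    exact (add_mem_param_iff hg hp he hf).2 h

/-- With `eq_of_mem_antipode`, this says that `nCoord` identifies `∞(p)` with `A`. -/
theorem exists_mem_antipode {p : unitarySet A} {g : A} (hp : p.1 = graph g) (r : A) :
    ∃ f ∈ antipode p.1, nCoord f = r :=
  ⟨poleComb (r, -g * r), by rw [hp, antipode_graph]; exact poleComb_mem_graph _ _,
    nCoord_poleComb _ _⟩

theorem eq_of_mem_antipode {p : unitarySet A} {g : A} (hp : p.1 = graph g) {f f' : A × A}
    (hf : f ∈ antipode p.1) (hf' : f' ∈ antipode p.1) (h : nCoord f = nCoord f') : f = f' := by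
  rw [hp, antipode_graph] at hf hf'
  refine ext_coord h ?_
  rw [mem_graph.1 hf, mem_graph.1 hf', h]

theorem param_add (p : unitarySet A) (z w : selfAdjoint A) :
    param p (z + w) = cellAdd p.1 (param p z) (param p w) := by
  obtain ⟨g, hg, hp⟩ := exists_eq_graph p.2
  ext m
  rw [mem_param_iff_exists_add hg hp]
  constructor
  · rintro ⟨e, he, f, hf, h, rfl⟩
    obtain ⟨f₁, hf₁, h₁⟩ := exists_mem_antipode hp (-(Complex.I • (z : A)) * nCoord e)
    obtain ⟨f₂, hf₂, h₂⟩ := exists_mem_antipode hp (-(Complex.I • (w : A)) * nCoord e)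
    refine ⟨e, he, f₁, hf₁, f₂, hf₂, (add_mem_param_iff hg hp he hf₁).2 h₁,
      (add_mem_param_iff hg hp he hf₂).2 h₂, ?_⟩
    congr 1
    refine eq_of_mem_antipode hp hf (add_mem hf₁ hf₂) ?_
    rw [h, map_add, h₁, h₂, ← add_mul, ← neg_add, ← smul_add]
    rfl
  · rintro ⟨e, he, f₁, hf₁, f₂, hf₂, h₁, h₂, rfl⟩
    refine ⟨e, he, f₁ + f₂, add_mem hf₁ hf₂, ?_, rfl⟩
    rw [map_add, (add_mem_param_iff hg hp he hf₁).1 h₁, (add_mem_param_iff hg hp he hf₂).1 h₂,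
      ← add_mul, ← neg_add, ← smul_add]
    rfl

theorem smul_mem_antipode {p : unitarySet A} {g : A} (hp : p.1 = graph g) (c : ℂ) {f : A × A}
    (hf : f ∈ antipode p.1) : c • f ∈ antipode p.1 := by
  rw [hp, antipode_graph, mem_graph] at hf ⊢
  rw [sCoord_smul, nCoord_smul, hf, mul_smul_comm]

theorem param_smul [StarModule ℂ A] (p : unitarySet A) (r : ℝ) (z : selfAdjoint A) :
    param p (r • z) = cellSMul p.1 r (param p z) := by
  obtain ⟨g, hg, hp⟩ := exists_eq_graph p.2
  have hr : ((r • z : selfAdjoint A) : A) = (r : ℂ) • (z : A) := rfl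
  ext m
  rw [mem_param_iff_exists_add hg hp]
  constructor
  · rintro ⟨e, he, f, hf, h, rfl⟩
    obtain ⟨f₁, hf₁, h₁⟩ := exists_mem_antipode hp (-(Complex.I • (z : A)) * nCoord e)
    refine ⟨e, he, f₁, hf₁, (add_mem_param_iff hg hp he hf₁).2 h₁, ?_⟩
    congr 1
    refine eq_of_mem_antipode hp hf (smul_mem_antipode hp _ hf₁) ?_
    rw [h, nCoord_smul, h₁, hr, smul_comm, ← smul_neg, smul_mul_assoc]
  · rintro ⟨e, he, f, hf, h, rfl⟩
    refine ⟨e, he, (r : ℂ) • f, smul_mem_antipode hp _ hf, ?_, rfl⟩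
    rw [nCoord_smul, (add_mem_param_iff hg hp he hf).1 h, hr, smul_comm]
    simp only [neg_mul, smul_mul_assoc, smul_neg]

end VectorSpace

end CompletedQM

namespace CompletedQM

open Filter Topology

/-! ### Fibres of the space of complete observables -/

section Observables

variable {A : Type*} [Ring A] [StarRing A] [Algebra ℂ A] [StarModule ℂ A]

theorem realCell_subset_unitarySet (hpos : IsPStarAlgebra A) (p : unitarySet A) :
    realCell (antipode p.1) ⊆ unitarySet A := fun x hx ↦ by
  rw [← param_coord hpos hx]
  exact param_mem_unitarySet hpos p _

/-- For unitaries `g` and `h`, both transversality conditions say that `g + h` is invertible. That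
`x` lies in `U` comes from `realCell_subset_unitarySet`. -/
theorem mem_completeObservables_iff (hpos : IsPStarAlgebra A) {p : unitarySet A} {x : RSub A} :
    (p.1, x) ∈ completeObservables A ↔ x ∈ realCell (antipode p.1) := by
  obtain ⟨g, hg, hp⟩ := exists_eq_graph p.2
  have key : ∀ h ∈ unitary A, (IsCompl p.1 (antipode (graph h)) ↔
      graph h ∈ realCell (antipode p.1)) := fun h hh ↦ by
    rw [hp, graph_mem_realCell_iff hh, antipode_graph, isCompl_graph_iff, sub_neg_eq_add, add_comm]
  constructor
  · rintro ⟨-, hx, hc⟩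
    obtain ⟨h, hh, rfl⟩ := exists_eq_graph hx
    exact (key h hh).1 hc
  · intro hx
    obtain ⟨h, hh, rfl⟩ := exists_eq_graph (realCell_subset_unitarySet hpos p hx)
    exact ⟨p.2, graph_mem_unitarySet hh, (key h hh).2 hx⟩

end Observables

/-! ### Differentiability of the changes of charts -/

section Smooth

instance continuousSMul_real_of_complex {M : Type*} [AddCommGroup M] [Module ℂ M]
    [TopologicalSpace M] [ContinuousSMul ℂ M] : ContinuousSMul ℝ M where
  continuous_smul := by
    change Continuous fun p : ℝ × M ↦ (p.1 : ℂ) • p.2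
    fun_prop

instance continuousSMul_selfAdjoint {A : Type*} [Ring A] [StarRing A] [Algebra ℂ A]
    [StarModule ℂ A] [TopologicalSpace A] [ContinuousSMul ℂ A] :
    ContinuousSMul ℝ (selfAdjoint A) where
  continuous_smul := by
    refine Continuous.subtype_mk (f := fun p : ℝ × selfAdjoint A ↦ p.1 • (p.2 : A)) ?_ _
    fun_prop

theorem continuousAt_ringInverse {A : Type*} [Ring A] [TopologicalSpace A]
    (hunits : IsOpen {a : A | IsUnit a})
    (hinv : ContinuousOn (Ring.inverse : A → A) {a : A | IsUnit a}) {a : A} (ha : IsUnit a) :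
    ContinuousAt Ring.inverse a :=
  hinv.continuousAt (hunits.mem_nhds ha)

variable {A : Type*} [Ring A] [StarRing A] [Algebra ℂ A] [TopologicalSpace A]
  [IsTopologicalRing A]

theorem continuous_cayley (hunits : IsOpen {a : A | IsUnit a})
    (hinv : ContinuousOn (Ring.inverse : A → A) {a : A | IsUnit a}) (hpos : IsPStarAlgebra A) :
    Continuous fun z : selfAdjoint A ↦ cayley (z : A) := by
  refine Continuous.mul (by fun_prop) (continuous_iff_continuousAt.2 fun z ↦ ?_)
  exact ContinuousAt.comp (f := fun z : selfAdjoint A ↦ 1 - Complex.I • (z : A))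
    (continuousAt_ringInverse hunits hinv (isUnit_one_sub_I_smul hpos z.2)) (by fun_prop)

theorem isOpen_isUnit_mul_cayley_add (hunits : IsOpen {a : A | IsUnit a})
    (hinv : ContinuousOn (Ring.inverse : A → A) {a : A | IsUnit a}) (hpos : IsPStarAlgebra A)
    (g h : A) : IsOpen {z : selfAdjoint A | IsUnit (g * cayley (z : A) + h)} :=
  hunits.preimage (((continuous_cayley hunits hinv hpos).const_mul g).add continuous_const)

variable [StarModule ℂ A]

/-- The points of the cell of `q` have open preimage under the parametrization at `p`. -/
theorem isOpen_param_preimage (hunits : IsOpen {a : A | IsUnit a})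
    (hinv : ContinuousOn (Ring.inverse : A → A) {a : A | IsUnit a}) (hpos : IsPStarAlgebra A)
    (p q : unitarySet A) : IsOpen (param p ⁻¹' realCell (antipode q.1)) := by
  obtain ⟨g, hg, hp⟩ := exists_eq_graph p.2
  obtain ⟨h, hh, hq⟩ := exists_eq_graph q.2
  convert isOpen_isUnit_mul_cayley_add hunits hinv hpos g h using 1
  ext z
  rw [Set.mem_preimage, param_eq_graph hpos hp, hq,
    graph_mem_realCell_iff (mul_mem hg (cayley_mem_unitary hpos z.2))]
  rfl

variable [ContinuousSMul ℂ A] [ContinuousStar A]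

/-- The two difference formulas combine to an increment `c(y) (y - z) d`, with `c` continuous at `z`
and `d` fixed, which is Carathéodory's form. -/
theorem differentiableAt_transition (hunits : IsOpen {a : A | IsUnit a})
    (hinv : ContinuousOn (Ring.inverse : A → A) {a : A | IsUnit a}) (hpos : IsPStarAlgebra A)
    {p q : unitarySet A} {z : selfAdjoint A} (hz : param p z ∈ realCell (antipode q.1)) :
    DifferentiableAt ℝ (transition p q) z := by
  obtain ⟨g, hg, hp⟩ := exists_eq_graph p.2
  obtain ⟨h, hh, hq⟩ := exists_eq_graph q.2
  rw [param_eq_graph hpos hp, hq,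
    graph_mem_realCell_iff (mul_mem hg (cayley_mem_unitary hpos z.2))] at hz
  have hu : ∀ y : selfAdjoint A, IsUnit (g * cayley (y : A) + h) →
      IsUnit (star h * g * cayley (y : A) + 1) := fun y hy ↦ by
    have := (isUnit_of_mem_unitary (Unitary.star_mem hh)).mul hy
    rwa [mul_add, ← mul_assoc, (Unitary.mem_iff.1 hh).1] at this
  -- The factor 4 is `(-2i)(2i)`, from the difference formulas for `invCayley` and `cayley`.
  set c : selfAdjoint A → A := fun y ↦ (4 : ℂ) • (Ring.inverse (star h * g * cayley (y : A) + 1) *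
    (star h * g) * Ring.inverse (1 - Complex.I • (y : A))) with hc
  set d : A := Ring.inverse (1 - Complex.I • (z : A)) *
    Ring.inverse (star h * g * cayley (z : A) + 1) with hd
  have hcont : ContinuousAt c z := by
    refine ContinuousAt.const_smul (.mul (.mul ?_ continuousAt_const) ?_) _
    · exact ContinuousAt.comp (f := fun y : selfAdjoint A ↦ star h * g * cayley (y : A) + 1)
        (continuousAt_ringInverse hunits hinv (hu z hz))
        (((continuous_cayley hunits hinv hpos).const_mul _).add continuous_const).continuousAt
    · exact ContinuousAt.comp (f := fun z : selfAdjoint A ↦ 1 - Complex.I • (z : A))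
        (continuousAt_ringInverse hunits hinv (isUnit_one_sub_I_smul hpos z.2)) (by fun_prop)
  -- The product is formed in `A`; taking the Hermitian part is a continuous real linear map back to
  -- `Herm(A)` that fixes the increment.
  refine differentiableAt_of_sub_eq_mul (R := A)
    (⟨LinearMap.mulRight ℝ d ∘ₗ (selfAdjoint.submodule ℝ A).subtype,
      continuous_subtype_val.mul_const d⟩ : selfAdjoint A →L[ℝ] A)
    (selfAdjointPartL ℝ A) hcont ?_
  filter_upwards [(isOpen_isUnit_mul_cayley_add hunits hinv hpos g h).mem_nhds hz] with y hy
  have key : ((transition p q y - transition p q z : selfAdjoint A) : A) =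
      c y * (((y - z : selfAdjoint A) : A) * d) := by
    rw [AddSubgroupClass.coe_sub, transition_eq hpos hg hh hp hq hy,
      transition_eq hpos hg hh hp hq hz, invCayley_sub_invCayley (hu y hy) (hu z hz), ← mul_sub,
      cayley_sub_cayley (isUnit_one_sub_I_smul hpos y.2) (isUnit_one_sub_I_smul hpos z.2),
      mul_smul_comm, mul_smul_comm, smul_mul_assoc, smul_smul, hc, smul_mul_assoc]
    congr 1
    · rw [mul_mul_mul_comm, Complex.I_mul_I]; norm_num
    · simp only [hd, mul_assoc, AddSubgroupClass.coe_sub]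
  change _ = selfAdjointPart ℝ (c y * (((y - z : selfAdjoint A) : A) * d))
  rw [← key]
  exact Subtype.ext (IsSelfAdjoint.coe_selfAdjointPart_apply ℝ (selfAdjoint.mem_iff.1
    (transition p q y - transition p q z).2)).symm

end Smooth

/-! ### Tangent spaces and the quantum identification -/

section Tangent

variable {A : Type*} [Ring A] [StarRing A] [Algebra ℂ A] [StarModule ℂ A]
  [TopologicalSpace A] [T2Space A] [IsTopologicalRing A] [ContinuousSMul ℂ A]

theorem fderiv_transition_self (hpos : IsPStarAlgebra A) (p : unitarySet A) (z : selfAdjoint A) :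
    fderiv ℝ (transition p p) z = ContinuousLinearMap.id ℝ (selfAdjoint A) := by
  have h : transition p p = ContinuousLinearMap.id ℝ (selfAdjoint A) :=
    funext fun w ↦ coord_param hpos p w
  rw [h]
  exact ContinuousLinearMap.fderiv _

variable [ContinuousStar A]

/-- The cocycle rule for the derivatives of the changes of charts. -/
theorem fderiv_transition_comp (hunits : IsOpen {a : A | IsUnit a})
    (hinv : ContinuousOn (Ring.inverse : A → A) {a : A | IsUnit a}) (hpos : IsPStarAlgebra A)
    {x : unitarySet A} (o p q : ChartAt x) :
    fderiv ℝ (transition o.1 q.1) (coord o.1 x.1) =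
      fderiv ℝ (transition p.1 q.1) (coord p.1 x.1) ∘L
        fderiv ℝ (transition o.1 p.1) (coord o.1 x.1) := by
  have hx : ∀ r : ChartAt x, param r.1 (coord r.1 x.1) = x.1 := fun r ↦ param_coord hpos r.2
  have hdiff : ∀ r s : ChartAt x, DifferentiableAt ℝ (transition r.1 s.1) (coord r.1 x.1) :=
    fun r s ↦ differentiableAt_transition hunits hinv hpos (by rw [hx]; exact s.2)
  have hop : transition o.1 p.1 (coord o.1 x.1) = coord p.1 x.1 := by
    rw [transition, Function.comp_apply, hx]
  have hcomp : transition o.1 q.1 =ᶠ[𝓝 (coord o.1 x.1)]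
      transition p.1 q.1 ∘ transition o.1 p.1 := by
    -- The composite agrees with the direct change of charts only where the point lies in the cell
    -- of `p`, since `coord` is arbitrary elsewhere; openness of this set suffices for derivatives.
    filter_upwards [(isOpen_param_preimage hunits hinv hpos o.1 p.1).mem_nhds
      (show param o.1 (coord o.1 x.1) ∈ _ by rw [hx]; exact p.2)] with z hz
    simp only [transition, Function.comp_apply]
    rw [param_coord hpos hz]
  rw [hcomp.fderiv_eq]
  refine HasFDerivAt.fderiv (HasFDerivAt.comp_tvs ?_ (hdiff o p).hasFDerivAt)
  rw [hop]
  exact (hdiff p q).hasFDerivAt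

/-- The transformation rule out of the centred chart determines all components. Conversely,
transporting any `a` by the derivatives gives a compatible family, by the cocycle rule. -/
theorem tangentSp_component_bijective (hunits : IsOpen {a : A | IsUnit a})
    (hinv : ContinuousOn (Ring.inverse : A → A) {a : A | IsUnit a}) (hpos : IsPStarAlgebra A)
    (x : unitarySet A) :
    Function.Bijective fun v : TangentSp x ↦ v.1 (ChartAt.self x) := by
  constructor
  · intro v w hvw
    apply Subtype.ext
    funext q
    rw [v.2 (ChartAt.self x) q, w.2 (ChartAt.self x) q]
    exact congrArg _ hvw
  · intro a
    refine ⟨⟨fun q ↦ fderiv ℝ (transition (ChartAt.self x).1 q.1)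
      (coord (ChartAt.self x).1 x.1) a, fun p q ↦ ?_⟩, ?_⟩
    · change fderiv ℝ (transition (ChartAt.self x).1 q.1) (coord (ChartAt.self x).1 x.1) a = _
      rw [fderiv_transition_comp hunits hinv hpos (ChartAt.self x) p q]
      rfl
    · change fderiv ℝ (transition (ChartAt.self x).1 (ChartAt.self x).1) _ a = a
      rw [fderiv_transition_self hpos]
      rfl

theorem quantumIdent_bijOn (hunits : IsOpen {a : A | IsUnit a})
    (hinv : ContinuousOn (Ring.inverse : A → A) {a : A | IsUnit a}) (hpos : IsPStarAlgebra A)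
    {hbar : ℝ} (hhbar : hbar ≠ 0) (p : unitarySet A) :
    Set.BijOn (quantumIdent hbar p) Set.univ (realCell (antipode p.1)) := by
  have hsmul : Function.Bijective fun w : selfAdjoint A ↦ hbar • w :=
    MulAction.bijective (Units.mk0 hbar hhbar)
  exact (param_bijOn hpos p).comp (Set.bijOn_univ.2
    (hsmul.comp (tangentSp_component_bijective hunits hinv hpos p)))

end Tangent

end CompletedQM

/-! ### The main theorem -/

open CompletedQM in
theorem mainTheorem8 {A : Type*} [Ring A] [StarRing A] [Algebra ℂ A] [StarModule ℂ A]
    [TopologicalSpace A] [T2Space A] [IsTopologicalRing A] [ContinuousSMul ℂ A] [ContinuousStar A]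
    (hunits : IsOpen {a : A | IsUnit a})
    (hinv : ContinuousOn (Ring.inverse : A → A) {a : A | IsUnit a})
    (hpos : IsPStarAlgebra A) (hbar : ℝ) (hhbar : hbar ≠ 0) :
    (∀ p : unitarySet A,
      realCell (antipode p.1) ⊆ unitarySet A ∧
      Set.BijOn (quantumIdent hbar p) Set.univ (realCell (antipode p.1)) ∧
      quantumIdent hbar p 0 = p.1 ∧
      (∀ v w : TangentSp p, quantumIdent hbar p (v + w) =
        cellAdd p.1 (quantumIdent hbar p v) (quantumIdent hbar p w)) ∧
      (∀ (r : ℝ) (v : TangentSp p), quantumIdent hbar p (r • v) =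
        cellSMul p.1 r (quantumIdent hbar p v))) ∧
    Set.BijOn (fun v : TBundle A => ((v.1 : RSub A), quantumIdent hbar v.1 v.2))
      Set.univ (completeObservables A) := by
  have hbij := quantumIdent_bijOn hunits hinv hpos hhbar
  refine ⟨fun p ↦ ⟨realCell_subset_unitarySet hpos p, hbij p, ?_, fun v w ↦ ?_, fun r v ↦ ?_⟩,
    ?_, ?_, ?_⟩
  · change param p (hbar • (0 : selfAdjoint A)) = p.1
    rw [smul_zero, param_zero hpos]
  · change param p (hbar • (v.1 _ + w.1 _)) = _
    rw [smul_add, param_add]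
    rfl
  · change param p (hbar • r • v.1 _) = _
    rw [smul_comm, param_smul]
    rfl
  -- Since the fibre of `O_U` over `p` is the cell of `∞(p)`, the bundle map is bijective because
  -- each `Q_p` is.
  · rintro ⟨p, v⟩ -
    exact (mem_completeObservables_iff hpos).2 ((hbij p).mapsTo trivial)
  · rintro ⟨p, v⟩ - ⟨q, w⟩ - h
    obtain ⟨h1, h2⟩ := Prod.mk.inj h
    obtain rfl : p = q := Subtype.ext h1
    exact congrArg (Sigma.mk p) ((hbij p).injOn trivial trivial h2)
  · rintro ⟨y, x⟩ hyx
    obtain ⟨v, -, hv⟩ := (hbij ⟨y, hyx.1⟩).surjOn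
      ((mem_completeObservables_iff (p := ⟨y, hyx.1⟩) hpos).1 hyx)
    exact ⟨⟨⟨y, hyx.1⟩, v⟩, trivial, Prod.ext rfl hv⟩
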